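/- Let $k\in\mathbb{N}$ and let $\Lambda$ be a finite $k$-graph (a small category with a degree functor $d:\Lambda\to\mathbb{N}^k$ satisfying the unique factorisation property, such that $\Lambda^n:=d^{-1}(n)$ is finite for every $n\in\mathbb{N}^k$). For $1\le i\le k$ let $A_i$ be the vertex matrix with entries $A_i(v,w)=|v\Lambda^{e_i}w|$, the number of paths of degree $e_i$ with range $v$ and source $w$ ($v,w\in\Lambda^0$), and let $\rho(A_i)$ be its spectral radius. Suppose that $\Lambda$ is coordinatewise irreducible: each $A_i$ is irreducible, that is, for all $v,w\in\Lambda^0$ there is $n\ge 1$ with $A_i^n(v,w)\ne 0$. A Toeplitz-Cuntz-Krieger $\Lambda$-family consists of partial isometries $\{T_\lambda:\lambda\in\Lambda\}$ such that (T1) the $Q_v:=T_v$, $v\in\Lambda^0$, are mutually orthogonal projections; (T2) $T_\lambda T_\mu=T_{\lambda\mu}$ whenever $s(\lambda)=r(\mu)$; (T3) $T_\lambda^*T_\lambda=Q_{s(\lambda)}$; (T4) $Q_v\ge\sum_{\lambda\in v\Lambda^n}T_\lambda T_\lambda^*$ for all $v\in\Lambda^0$, $n\in\mathbb{N}^k$;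 (T5) $T_\mu^*T_\nu=\sum T_\eta T_\zeta^*$, summed over all pairs $(\eta,\zeta)$ with $\mu\eta=\nu\zeta$ and $d(\mu\eta)=d(\mu)\vee d(\nu)$ (an empty sum being $0$). It is a Cuntz-Krieger $\Lambda$-family if equality holds in (T4) for all $v$ and $n$. Let $\mathcal{T}C^*(\Lambda)$ and $C^*(\Lambda)$ be the $C^*$-algebras generated by a universal Toeplitz-Cuntz-Krieger $\Lambda$-family and a universal Cuntz-Krieger $\Lambda$-family $\{t_\lambda\}$, respectively. On each of them let $\gamma$ be the gauge action of $\mathbb{T}^k$, with $\gamma_z(t_\lambda)=z^{d(\lambda)}t_\lambda$. Fix $r\in(0,\infty)^k$ and put $\alpha_t=\gamma_{e^{itr}}$ for $t\in\mathbb{R}$. For $\beta\in(0,\infty)$, a KMS$_\beta$ state is a state $\phi$ with $\phi(ab)=\phi(b\,\alpha_{i\beta}(a))$ for all analytic elements $a,b$ (those $a$ for which $t\mapsto\alpha_t(a)$ extends to an entire function $z\mapsto\alpha_z(a)$); the KMS$_0$ states are the $\alpha$-invariant tracial states. Let $\beta\in[0,\infty)$. 1. If there is a KMS$_\beta$ state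 of $(\mathcal{T}C^*(\Lambda),\alpha)$, then for every $1\le i\le k$ we have $\rho(A_i)>0$ and $\beta r_i\ge\ln\rho(A_i)\ge 0$. 2. If there is a KMS$_\beta$ state of $(C^*(\Lambda),\alpha)$, then for every $1\le i\le k$ we have $\rho(A_i)>0$ and $\beta r_i=\ln\rho(A_i)$. -/

import Mathlib

open CategoryTheory
open scoped ENNReal ComplexOrder

universe u

/-- A `k`-graph with vertex set `V`: a small category with object set `V` and a degree functor
`d` to `ℕ^k` with the unique factorisation property.  A morphism `f : w ⟶ v` is a path with source
`w` and range `v`; the path usually written `λμ` (with `s(λ) = r(μ)`) is the morphism `μ ≫ λ`. -/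
structure KGraph (k : ℕ) (V : Type u) [SmallCategory V] where
  d : ∀ {w v : V}, (w ⟶ v) → (Fin k → ℕ)
  d_id : ∀ v : V, d (𝟙 v) = 0
  d_comp : ∀ {x w v : V} (f : x ⟶ w) (g : w ⟶ v), d (f ≫ g) = d f + d g
  factorisation : ∀ {w v : V} (f : w ⟶ v) (m n : Fin k → ℕ), d f = m + n →
    ∃! p : Σ x : V, (w ⟶ x) × (x ⟶ v),
      d p.2.2 = m ∧ d p.2.1 = n ∧ p.2.1 ≫ p.2.2 = f

namespace KGraph

variable {k : ℕ} {V : Type u} [SmallCategory V] (Λ : KGraph k V)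

/-- The `k`-graph is finite: for every `n`, the set of all paths of degree `n` is finite. -/
def IsFinite : Prop :=
  ∀ n : Fin k → ℕ, {p : Σ (w v : V), (w ⟶ v) | Λ.d p.2.2 = n}.Finite

/-- The set `vΛⁿ` of paths with range `v` and degree `n`. -/
def PathsInto (v : V) (n : Fin k → ℕ) : Type u :=
  {p : Σ w : V, (w ⟶ v) // Λ.d p.2 = n}

/-- The set `Λ^min(μ, ν)` of minimal common extensions `(η, ζ)`, meaning `μη = νζ` and
`d(μη) = d(μ) ∨ d(ν)`, of two paths `μ`, `ν` with the same range (if the ranges differ, there are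
no common extensions). -/
def MinExt {w w' v : V} (μ : w ⟶ v) (ν : w' ⟶ v) : Type u :=
  {p : Σ x : V, (x ⟶ w) × (x ⟶ w') //
    p.2.1 ≫ μ = p.2.2 ≫ ν ∧ Λ.d (p.2.1 ≫ μ) = Λ.d μ ⊔ Λ.d ν}

/-- The vertex matrix `A_i`, with entries `A_i(v, w) = |vΛ^{e_i}w|`. -/
noncomputable def vertexMatrix (i : Fin k) : Matrix V V ℝ :=
  Matrix.of fun v w => (Nat.card {f : w ⟶ v // Λ.d f = Pi.single i 1} : ℝ)

/-- All vertex matrices are irreducible: for each `i` and all `v`, `w` there is `n ≥ 1` with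
`(A_i ^ n)(v, w) ≠ 0`. -/
def CoordinatewiseIrreducible : Prop :=
  ∀ i : Fin k, (Λ.vertexMatrix i).IsIrreducible

/-- The spectral radius `ρ(A_i)` of the vertex matrix, as a complex matrix. -/
noncomputable def rho [Fintype V] [DecidableEq V] (i : Fin k) : ℝ :=
  (spectralRadius ℂ ((Λ.vertexMatrix i).map ((↑) : ℝ → ℂ))).toReal

/-- Toeplitz-Cuntz-Krieger `Λ`-families in a `C*`-algebra `B`; the vertex projection `Q_v` is
`T (𝟙 v)`.  In (T4), positivity of an element of a `C*`-algebra is expressed as `b* b`.  For a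
finite `k`-graph all sums are over finite sets. -/
structure IsToeplitzCuntzKrieger {B : Type*} [NonUnitalCStarAlgebra B]
    (T : ∀ {w v : V}, (w ⟶ v) → B) : Prop where
  partial_isometry : ∀ {w v : V} (f : w ⟶ v), T f * star (T f) * T f = T f
  T1_proj : ∀ v : V, IsStarProjection (T (𝟙 v))
  T1_orth : ∀ v w : V, v ≠ w → T (𝟙 v) * T (𝟙 w) = 0
  T2 : ∀ {x w v : V} (μ : x ⟶ w) (f : w ⟶ v), T f * T μ = T (μ ≫ f)
  T3 : ∀ {w v : V} (f : w ⟶ v), star (T f) * T f = T (𝟙 w)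
  T4 : ∀ (v : V) (n : Fin k → ℕ), ∃ b : B,
    T (𝟙 v) - ∑ᶠ p : Λ.PathsInto v n, T p.1.2 * star (T p.1.2) = star b * b
  T5 : ∀ {w w' v : V} (μ : w ⟶ v) (ν : w' ⟶ v),
    star (T μ) * T ν = ∑ᶠ p : Λ.MinExt μ ν, T p.1.2.1 * star (T p.1.2.2)
  T5_empty : ∀ {w w' v v' : V} (μ : w ⟶ v) (ν : w' ⟶ v'), v ≠ v' → star (T μ) * T ν = 0

/-- The Cuntz-Krieger relation. -/
def SatisfiesCK {B : Type*} [NonUnitalCStarAlgebra B]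
    (T : ∀ {w v : V}, (w ⟶ v) → B) : Prop :=
  ∀ (v : V) (n : Fin k → ℕ),
    T (𝟙 v) = ∑ᶠ p : Λ.PathsInto v n, T p.1.2 * star (T p.1.2)

end KGraph

/-- The two sets of relations: those of Toeplitz-Cuntz-Krieger families, and those of
Cuntz-Krieger families. -/
inductive KGraph.Kind
  | toeplitz
  | cuntzKrieger

namespace KGraph

variable {k : ℕ} {V : Type u} [SmallCategory V] (Λ : KGraph k V)

/-- The `Λ`-families of the given kind in arbitrary `C*`-algebras.  (The `C*`-algebra generated by a
family has, up to isomorphism, a model in `Type u`, so one universe suffices.) -/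
structure Family (κ : Kind) : Type (u + 1) where
  B : Type u
  [cstar : NonUnitalCStarAlgebra B]
  T : ∀ {w v : V}, (w ⟶ v) → B
  tck : Λ.IsToeplitzCuntzKrieger T
  ck : κ = Kind.cuntzKrieger → Λ.SatisfiesCK T

attribute [instance] Family.cstar

/-- The `C*`-algebra of bounded choices of an element in the target of every family. -/
abbrev BigProduct (κ : Kind) : Type (u + 1) := lp (fun R : Λ.Family κ => R.B) ∞

lemma norm_le_one {B : Type*} [NonUnitalCStarAlgebra B] (a p : B) (hp : IsStarProjection p)
    (h : star a * a = p) : ‖a‖ ≤ 1 := by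
  have h1 : ‖a‖ * ‖a‖ = ‖p‖ := by rw [← CStarRing.norm_star_mul_self, h]
  have h2 : ‖p‖ * ‖p‖ = ‖p‖ := by
    rw [← CStarRing.norm_star_mul_self, hp.isSelfAdjoint.star_eq, hp.isIdempotentElem.eq]
  nlinarith [norm_nonneg a, norm_nonneg p, sq_nonneg (‖p‖ - 1), sq_nonneg (‖a‖ - 1)]

/-- The path `f`, represented simultaneously in all families. -/
noncomputable def bigGen (κ : Kind) {w v : V} (f : w ⟶ v) : Λ.BigProduct κ :=
  ⟨fun R => R.T f, memℓp_infty ⟨1, by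
    rintro _ ⟨R, rfl⟩
    exact norm_le_one _ _ (R.tck.T1_proj w) (R.tck.T3 f)⟩⟩

/-- The closed `*`-subalgebra generated by the paths. -/
noncomputable def subalg (κ : Kind) : NonUnitalStarSubalgebra ℂ (Λ.BigProduct κ) :=
  (NonUnitalStarAlgebra.adjoin ℂ
    {x | ∃ (w v : V) (f : w ⟶ v), x = Λ.bigGen κ f}).topologicalClosure

/-- The universal `C*`-algebra generated by a `Λ`-family of the given kind: the closed
`*`-subalgebra generated by the simultaneous realization of all such families. -/
def Alg (κ : Kind) : Type (u + 1) := Λ.subalg κ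

noncomputable instance (κ : Kind) : NonUnitalCStarAlgebra (Λ.Alg κ) :=
  NonUnitalStarSubalgebra.nonUnitalCStarAlgebra (Λ.subalg κ)
    (h_closed := NonUnitalStarSubalgebra.isClosed_topologicalClosure _)

/-- The Toeplitz algebra `𝒯C*(Λ)`. -/
abbrev ToeplitzAlg : Type (u + 1) := Λ.Alg Kind.toeplitz

/-- The graph algebra `C*(Λ)`. -/
abbrev CKAlg : Type (u + 1) := Λ.Alg Kind.cuntzKrieger

/-- The generator of the universal algebra given by the path `f`. -/
noncomputable def gen (κ : Kind) {w v : V} (f : w ⟶ v) : Λ.Alg κ :=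
  ⟨Λ.bigGen κ f, NonUnitalStarSubalgebra.le_topologicalClosure _
    (NonUnitalStarAlgebra.subset_adjoin ℂ _ ⟨w, v, f, rfl⟩)⟩

/-- Multi-index notation `z^n` for `z ∈ 𝕋^k`. -/
noncomputable def zpow (z : Fin k → Circle) (n : Fin k → ℕ) : Circle := ∏ i, z i ^ n i

lemma zpow_add (z : Fin k → Circle) (m n : Fin k → ℕ) :
    zpow z (m + n) = zpow z m * zpow z n := by
  simp [zpow, pow_add, Finset.prod_mul_distrib]

lemma zpow_zero (z : Fin k → Circle) : zpow z 0 = 1 := by simp [zpow]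

lemma one_zpow (n : Fin k → ℕ) : zpow (1 : Fin k → Circle) n = 1 := by simp [zpow]

lemma mul_zpow (z w : Fin k → Circle) (n : Fin k → ℕ) :
    zpow (z * w) n = zpow z n * zpow w n := by
  simp [zpow, mul_pow, Finset.prod_mul_distrib]

lemma star_circle_mul (c : Circle) : star (c : ℂ) * (c : ℂ) = 1 := by
  have := Circle.coe_inv_eq_conj c
  rw [Complex.star_def, ← this, ← Circle.coe_mul]; simp

lemma circle_mul_star (c : Circle) : (c : ℂ) * star (c : ℂ) = 1 := by
  rw [mul_comm, star_circle_mul]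

/-- The family obtained from a family by multiplying `T f` by `z^{d(f)}`. -/
noncomputable def Family.twist {κ : Kind} (R : Λ.Family κ) (z : Fin k → Circle) : Λ.Family κ where
  B := R.B
  cstar := R.cstar
  T := fun f => (zpow z (Λ.d f) : ℂ) • R.T f
  tck := by
    have hTT : ∀ {w v : V} (f : w ⟶ v), ((zpow z (Λ.d f) : ℂ) • R.T f) *
        star ((zpow z (Λ.d f) : ℂ) • R.T f) = R.T f * star (R.T f) := by
      intro w v f
      rw [star_smul, smul_mul_smul_comm, circle_mul_star, one_smul]
    have hid : ∀ v : V, (zpow z (Λ.d (𝟙 v)) : ℂ) • R.T (𝟙 v) = R.T (𝟙 v) := by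
      intro v; rw [Λ.d_id, zpow_zero]; simp
    refine ⟨?_, ?_, ?_, ?_, ?_, ?_, ?_, ?_⟩
    · intro w v f
      rw [hTT, mul_smul_comm, R.tck.partial_isometry]
    · intro v; rw [hid]; exact R.tck.T1_proj v
    · intro v w h; rw [hid, hid]; exact R.tck.T1_orth v w h
    · intro x w v μ f
      rw [smul_mul_smul_comm, R.tck.T2, Λ.d_comp, add_comm, zpow_add]; simp
    · intro w v f
      rw [star_smul, smul_mul_smul_comm, star_circle_mul, one_smul, hid, R.tck.T3]
    · intro v n
      simp only [hTT, hid]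
      exact R.tck.T4 v n
    · intro w w' v μ ν
      rw [star_smul, smul_mul_smul_comm, R.tck.T5, smul_finsum]
      refine finsum_congr fun p => ?_
      rw [star_smul, smul_mul_smul_comm]
      congr 1
      have h := congrArg (fun g => (zpow z (Λ.d g) : ℂ)) p.2.1
      simp only [Λ.d_comp, zpow_add, Circle.coe_mul] at h
      generalize ((zpow z (Λ.d p.1.2.1) : Circle)) = a at h ⊢
      have hb := star_circle_mul (zpow z (Λ.d p.1.2.2))
      have hm := star_circle_mul (zpow z (Λ.d μ))
      linear_combination (star (zpow z (Λ.d p.1.2.2) : ℂ) * star (zpow z (Λ.d μ) : ℂ)) * (-h)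
        + (a : ℂ) * star (zpow z (Λ.d p.1.2.2) : ℂ) * hm
        - (star (zpow z (Λ.d μ) : ℂ)) * (zpow z (Λ.d ν) : ℂ) * hb
    · intro w w' v v' μ ν h
      rw [star_smul, smul_mul_smul_comm, R.tck.T5_empty μ ν h, smul_zero]
  ck := by
    intro hκ v n
    have h := R.ck hκ v n
    have hid : ((zpow z (Λ.d (𝟙 v)) : Circle) : ℂ) • R.T (𝟙 v) = R.T (𝟙 v) := by
      rw [Λ.d_id, zpow_zero]; simp
    refine hid.trans (Eq.trans h (finsum_congr fun p => ?_))
    change _ = (((zpow z (Λ.d p.1.2) : Circle) : ℂ) • R.T p.1.2) *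
      star (((zpow z (Λ.d p.1.2) : Circle) : ℂ) • R.T p.1.2)
    rw [star_smul, smul_mul_smul_comm, circle_mul_star, one_smul]

lemma Family.twist_one {κ : Kind} (R : Λ.Family κ) : R.twist Λ 1 = R := by
  cases R
  simp [Family.twist, one_zpow]

lemma Family.mk_congr {κ : Kind} {B : Type u} [NonUnitalCStarAlgebra B]
    (T T' : ∀ {w v : V}, (w ⟶ v) → B) (h : @T = @T')
    (h1 : Λ.IsToeplitzCuntzKrieger T) (h1' : Λ.IsToeplitzCuntzKrieger T')
    (h2 : κ = Kind.cuntzKrieger → Λ.SatisfiesCK T)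
    (h2' : κ = Kind.cuntzKrieger → Λ.SatisfiesCK T') :
    Family.mk (Λ := Λ) (κ := κ) B T h1 h2 = Family.mk B T' h1' h2' := by
  subst h
  rfl

lemma Family.twist_twist {κ : Kind} (R : Λ.Family κ) (z w : Fin k → Circle) :
    (R.twist Λ z).twist Λ w = R.twist Λ (z * w) := by
  refine Family.mk_congr (B := R.B) Λ _ _ ?_ _ _ _ _
  funext a b f
  refine (smul_smul ((zpow w (Λ.d f) : Circle) : ℂ) ((zpow z (Λ.d f) : Circle) : ℂ)
    (R.T f)).trans ?_
  rw [← Circle.coe_mul, ← mul_zpow, mul_comm w z]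

/-- The gauge action on the product of all families, by permuting the families. -/
noncomputable def bigGauge (κ : Kind) (z : Fin k → Circle) :
    Λ.BigProduct κ →⋆ₙₐ[ℂ] Λ.BigProduct κ where
  toFun x := ⟨fun R => x (R.twist Λ z), memℓp_infty (by
    obtain ⟨C, hC⟩ := memℓp_infty_iff.1 x.2
    refine ⟨C, ?_⟩
    rintro _ ⟨R, rfl⟩
    exact hC ⟨R.twist Λ z, rfl⟩)⟩
  map_smul' _ _ := rfl
  map_zero' := rfl
  map_add' _ _ := rfl
  map_mul' _ _ := rfl
  map_star' _ := rfl

lemma bigGauge_one (κ : Kind) (x : Λ.BigProduct κ) : Λ.bigGauge κ 1 x = x := by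
  apply lp.ext
  funext R
  exact eq_of_heq (congr_arg_heq (fun R : Λ.Family κ => x R) (R.twist_one Λ))

lemma bigGauge_mul (κ : Kind) (z w : Fin k → Circle) (x : Λ.BigProduct κ) :
    Λ.bigGauge κ (z * w) x = Λ.bigGauge κ z (Λ.bigGauge κ w x) := by
  apply lp.ext
  funext R
  exact eq_of_heq (congr_arg_heq (fun R : Λ.Family κ => x R) (R.twist_twist Λ z w)).symm

lemma bigGauge_bigGen (κ : Kind) (z : Fin k → Circle) {w v : V} (f : w ⟶ v) :
    Λ.bigGauge κ z (Λ.bigGen κ f) = (zpow z (Λ.d f) : ℂ) • Λ.bigGen κ f := rfl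

lemma bigGauge_mem (κ : Kind) (z : Fin k → Circle) (x : Λ.BigProduct κ)
    (hx : x ∈ Λ.subalg κ) : Λ.bigGauge κ z x ∈ Λ.subalg κ := by
  have hle : Λ.subalg κ ≤ (Λ.subalg κ).comap (Λ.bigGauge κ z) := by
    refine NonUnitalStarSubalgebra.topologicalClosure_minimal _ ?_ ?_
    · refine NonUnitalStarAlgebra.adjoin_le ?_
      rintro _ ⟨w, v, f, rfl⟩
      change Λ.bigGauge κ z (Λ.bigGen κ f) ∈ Λ.subalg κ
      rw [bigGauge_bigGen]
      exact SMulMemClass.smul_mem _ (Λ.gen κ f).2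
    · exact (NonUnitalStarSubalgebra.isClosed_topologicalClosure _).preimage
        (AddMonoidHomClass.continuous_of_bound (Λ.bigGauge κ z) 1 fun x => by
          rw [one_mul]
          exact lp.norm_le_of_forall_le (norm_nonneg x)
            fun R => lp.norm_apply_le_norm ENNReal.top_ne_zero x (R.twist Λ z))
  exact hle hx

/-- The gauge action `γ` of `𝕋^k` on the universal algebra. -/
noncomputable def gauge (κ : Kind) :
    (Fin k → Circle) →* (Λ.Alg κ ≃⋆ₐ[ℂ] Λ.Alg κ) where
  toFun z :=
    { toFun := fun x => ⟨Λ.bigGauge κ z x.1, Λ.bigGauge_mem κ z x.1 x.2⟩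
      invFun := fun x => ⟨Λ.bigGauge κ z⁻¹ x.1, Λ.bigGauge_mem κ z⁻¹ x.1 x.2⟩
      left_inv := fun x => Subtype.ext (by
        change Λ.bigGauge κ z⁻¹ (Λ.bigGauge κ z x.1) = x.1
        rw [← bigGauge_mul, inv_mul_cancel, bigGauge_one])
      right_inv := fun x => Subtype.ext (by
        change Λ.bigGauge κ z (Λ.bigGauge κ z⁻¹ x.1) = x.1
        rw [← bigGauge_mul, mul_inv_cancel, bigGauge_one])
      map_mul' := fun _ _ => rfl
      map_add' := fun _ _ => rfl
      map_star' := fun _ => rfl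
      map_smul' := fun _ _ => rfl }
  map_one' := by
    ext x
    exact Subtype.ext (Λ.bigGauge_one κ x.1)
  map_mul' z w := by
    ext x
    exact Subtype.ext (Λ.bigGauge_mul κ z w x.1)

/-- The gauge action is the expected one on generators: `γ_z(t_f) = z^{d(f)} t_f`. -/
lemma gauge_gen (κ : Kind) (z : Fin k → Circle) {w v : V} (f : w ⟶ v) :
    Λ.gauge κ z (Λ.gen κ f) = (zpow z (Λ.d f) : ℂ) • Λ.gen κ f := rfl

/-- The dynamics `α_t = γ_{e^{itr}}`. -/
noncomputable def dynamics (κ : Kind) (r : Fin k → ℝ) (t : ℝ) : Λ.Alg κ ≃⋆ₐ[ℂ] Λ.Alg κ :=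
  Λ.gauge κ fun i => Circle.exp (t * r i)

end KGraph

/-- A state of a `C*`-algebra: a positive linear functional of norm `1`. -/
def IsCStarState {A : Type*} [NonUnitalCStarAlgebra A] (φ : A →L[ℂ] ℂ) : Prop :=
  (∀ a : A, 0 ≤ φ (star a * a)) ∧ ‖φ‖ = 1

/-- `F` is an entire extension `z ↦ α_z(a)` of `t ↦ α_t(a)`. -/
def IsEntireOrbit {A : Type*} [NonUnitalCStarAlgebra A] (α : ℝ → (A ≃⋆ₐ[ℂ] A)) (a : A)
    (F : ℂ → A) : Prop :=
  Differentiable ℂ F ∧ ∀ t : ℝ, F (t : ℂ) = α t a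

/-- `a` is analytic for `α`. -/
def IsAnalyticElement {A : Type*} [NonUnitalCStarAlgebra A] (α : ℝ → (A ≃⋆ₐ[ℂ] A)) (a : A) :
    Prop :=
  ∃ F : ℂ → A, IsEntireOrbit α a F

/-- `φ` is a KMS state of `(A, α)` at inverse temperature `β ∈ [0, ∞)`: a state such that, for
`β > 0`, `φ(ab) = φ(b α_{iβ}(a))` for all analytic `a`, `b`; the KMS states at `β = 0` are by
convention the `α`-invariant tracial states. -/
def IsKMSState {A : Type*} [NonUnitalCStarAlgebra A] (α : ℝ → (A ≃⋆ₐ[ℂ] A)) (β : ℝ)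
    (φ : A →L[ℂ] ℂ) : Prop :=
  IsCStarState φ ∧
  (0 < β → ∀ (a b : A) (F : ℂ → A), IsEntireOrbit α a F → IsAnalyticElement α b →
    φ (a * b) = φ (b * F (Complex.I * (β : ℂ)))) ∧
  (β = 0 → (∀ a b : A, φ (a * b) = φ (b * a)) ∧ ∀ (t : ℝ) (a : A), φ (α t a) = φ a)

/-! For a KMS state `φ`, put `m v = φ(Q_v)`. The KMS condition gives `φ(T_λ T_λ*) = exp(-β r·d(λ))
m(s(λ))`, so applying `φ` to (T4) in degree `e_i` yields `A_i m ≤ exp(β r_i) m`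
(`mulVec_le_of_isKMSState`), with equality under the Cuntz-Krieger relation
(`mulVec_eq_of_isKMSState`). The `Q_v` sum to the unit, so `m ≠ 0`, and irreducibility makes `m`
strictly positive.

A positive subinvariant vector bounds the spectral radius: `ρ(A_i) ≤ exp(β r_i)`. In the
Cuntz-Krieger case `exp(β r_i)` is an eigenvalue, which gives the reverse inequality. Finally
`ρ(A_i) ≥ 1`, because an irreducible matrix of natural numbers has no zero row. -/

namespace Matrix

/-! ### Perron-Frobenius estimates for nonnegative matrices. -/

variable {n : Type*} [Fintype n] [DecidableEq n]

open Filter Topology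

/-- A nonzero subinvariant vector of an irreducible matrix is strictly positive. -/
lemma IsIrreducible.pos_of_mulVec_le {A : Matrix n n ℝ} (hA : A.IsIrreducible) {m : n → ℝ} {c : ℝ}
    (hc : 0 ≤ c) (hm : 0 ≤ m) (hm0 : m ≠ 0) (h : A *ᵥ m ≤ c • m) (i : n) : 0 < m i := by
  have hpow : ∀ l : ℕ, A ^ l *ᵥ m ≤ c ^ l • m := by
    intro l
    induction l with
    | zero => simp
    | succ l ih =>
      rw [pow_succ', ← mulVec_mulVec]
      calc A *ᵥ (A ^ l *ᵥ m) ≤ A *ᵥ (c ^ l • m) := fun i =>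
            Finset.sum_le_sum fun j _ => mul_le_mul_of_nonneg_left (ih j) (hA.nonneg i j)
        _ = c ^ l • (A *ᵥ m) := mulVec_smul _ _ _
        _ ≤ c ^ l • (c • m) := smul_le_smul_of_nonneg_left h (pow_nonneg hc l)
        _ = c ^ (l + 1) • m := by rw [smul_smul, pow_succ]
  have hnn : ∀ l : ℕ, ∀ i j, 0 ≤ (A ^ l) i j := fun l => by
    induction l with
    | zero => intro i j; rw [pow_zero, one_apply]; split_ifs <;> norm_num
    | succ l ih =>
      intro i j
      rw [pow_succ, mul_apply]
      exact Finset.sum_nonneg fun x _ => mul_nonneg (ih i x) (hA.nonneg x j)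
  obtain ⟨j, hj⟩ := Function.ne_iff.1 hm0
  have hj : 0 < m j := lt_of_le_of_ne (hm j) (Ne.symm hj)
  -- Irreducibility carries positivity from `j` to `i`: `0 < (A ^ l) i j * m j ≤ c ^ l * m i`.
  obtain ⟨l, -, hl⟩ := (isIrreducible_iff_exists_pow_pos hA.nonneg).1 hA i j
  have h1 : 0 < (A ^ l *ᵥ m) i := (mul_pos hl hj).trans_le
    (Finset.single_le_sum (f := fun j => (A ^ l) i j * m j)
      (fun x _ => mul_nonneg (hnn l i x) (hm x)) (Finset.mem_univ j))
  have h2 : 0 < c ^ l * m i := h1.trans_le (hpow l i)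
  exact pos_of_mul_pos_right h2 (pow_nonneg hc l)

/-- An eigenvalue of a complex matrix has an eigenvector, in coordinates. -/
lemma exists_mulVec_eq_smul_of_mem_spectrum {B : Matrix n n ℂ} {μ : ℂ} (h : μ ∈ spectrum ℂ B) :
    ∃ x : n → ℂ, x ≠ 0 ∧ B *ᵥ x = μ • x := by
  rw [← spectrum_toLin', ← Module.End.hasEigenvalue_iff_mem_spectrum] at h
  obtain ⟨x, hx⟩ := h.exists_hasEigenvector
  exact ⟨x, hx.2, by simpa using hx.apply_eq_smul⟩

lemma mem_spectrum_of_mulVec_eq_smul {B : Matrix n n ℂ} {μ : ℂ} {x : n → ℂ} (hx : x ≠ 0)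
    (h : B *ᵥ x = μ • x) : μ ∈ spectrum ℂ B := by
  rw [← spectrum_toLin', ← Module.End.hasEigenvalue_iff_mem_spectrum]
  exact Module.End.hasEigenvalue_of_hasEigenvector
    (Module.End.hasEigenvector_iff.2 ⟨Module.End.mem_eigenspace_iff.2 (by simpa using h), hx⟩)

/-- A strictly positive subinvariant vector bounds the spectral radius of a nonnegative matrix. -/
lemma spectralRadius_le_of_mulVec_le {A : Matrix n n ℝ} (hA : ∀ i j, 0 ≤ A i j) {m : n → ℝ} {c : ℝ}
    (hm : ∀ i, 0 < m i) (h : A *ᵥ m ≤ c • m) :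
    spectralRadius ℂ (A.map ((↑) : ℝ → ℂ)) ≤ ENNReal.ofReal c := by
  refine iSup₂_le fun μ hμ => ?_
  obtain ⟨x, hx0, hx⟩ := exists_mulVec_eq_smul_of_mem_spectrum hμ
  obtain ⟨j, hj⟩ := Function.ne_iff.1 hx0
  have : Nonempty n := ⟨j⟩
  -- In the sup norm weighted by `m`, subinvariance says that `A` has norm at most `c`; the
  -- eigenvector is tested at a coordinate attaining this norm.
  obtain ⟨i, hi⟩ := Finite.exists_max fun i => ‖x i‖ / m i
  set M := ‖x i‖ / m i with hM
  have hxi : ‖x i‖ = M * m i := by rw [hM, div_mul_cancel₀ _ (hm i).ne']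
  have hMpos : 0 < M := (div_pos (norm_pos_iff.2 hj) (hm j)).trans_le (hi j)
  have key : ‖μ‖ * (M * m i) ≤ c * (M * m i) := by
    calc ‖μ‖ * (M * m i) = ‖(A.map ((↑) : ℝ → ℂ) *ᵥ x) i‖ := by
          rw [hx, Pi.smul_apply, smul_eq_mul, norm_mul, hxi]
      _ ≤ ∑ j, A i j * ‖x j‖ := by
          refine (norm_sum_le _ _).trans (Finset.sum_le_sum fun j _ => ?_)
          simp [abs_of_nonneg (hA i j)]
      _ ≤ ∑ j, A i j * (M * m j) := Finset.sum_le_sum fun j _ =>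
          mul_le_mul_of_nonneg_left ((div_le_iff₀ (hm j)).1 (hi j)) (hA i j)
      _ = M * (A *ᵥ m) i := by
          rw [mulVec, dotProduct, Finset.mul_sum]
          exact Finset.sum_congr rfl fun j _ => by ring
      _ ≤ M * (c * m i) := mul_le_mul_of_nonneg_left (h i) hMpos.le
      _ = c * (M * m i) := by ring
  have := le_of_mul_le_mul_right key (mul_pos hMpos (hm i))
  rw [← enorm_eq_nnnorm, ← ofReal_norm]
  exact ENNReal.ofReal_le_ofReal this

attribute [local instance] Matrix.linftyOpNormedRing Matrix.linftyOpNormedAlgebra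

/-- Ensures that `toReal` in `rho` loses nothing. The bound used is the norm of the first power
(index `0` means exponent `0 + 1`). -/
lemma spectralRadius_ne_top (B : Matrix n n ℂ) : spectralRadius ℂ B ≠ ⊤ := by
  refine ne_top_of_le_ne_top ?_ (spectrum.spectralRadius_le_pow_nnnorm_pow_one_div ℂ B 0)
  simp [ENNReal.mul_eq_top]

/-- A nonnegative matrix all of whose row sums are at least `1` has spectral radius at
least `1`. -/
lemma one_le_spectralRadius_of_one_le_mulVec [Nonempty n] {A : Matrix n n ℝ}
    (hA : ∀ i j, 0 ≤ A i j) (h : 1 ≤ A *ᵥ 1) :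
    1 ≤ spectralRadius ℂ (A.map ((↑) : ℝ → ℂ)) := by
  have hpow : ∀ l : ℕ, 1 ≤ A ^ l *ᵥ 1 := by
    intro l
    induction l with
    | zero => simp
    | succ l ih =>
      rw [pow_succ', ← mulVec_mulVec]
      exact h.trans fun i => Finset.sum_le_sum fun j _ => mul_le_mul_of_nonneg_left (ih j) (hA i j)
  -- By Gelfand's formula it suffices that every power has norm at least `1`; in the row-sum norm
  -- this is seen on the all-ones vector.
  refine ge_of_tendsto (spectrum.pow_nnnorm_pow_one_div_tendsto_nhds_spectralRadius
    (A.map ((↑) : ℝ → ℂ))) ((eventually_gt_atTop 0).mono fun l hl =>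
      ENNReal.one_le_rpow ?_ (by positivity))
  obtain ⟨i⟩ := ‹Nonempty n›
  have hmap : (A.map ((↑) : ℝ → ℂ)) ^ l *ᵥ 1 = fun i => (((A ^ l *ᵥ 1) i : ℝ) : ℂ) := by
    have h1 : (A.map ((↑) : ℝ → ℂ)) ^ l = (A ^ l).map ((↑) : ℝ → ℂ) :=
      (map_pow (RingHom.mapMatrix Complex.ofRealHom) A l).symm
    ext i
    rw [h1]
    simp [mulVec, dotProduct]
  have h1 : ‖(1 : n → ℂ)‖ ≤ 1 := (pi_norm_le_iff_of_nonneg zero_le_one).2 fun i => by simp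
  have h2 : 1 ≤ ‖((A.map ((↑) : ℝ → ℂ)) ^ l *ᵥ 1) i‖ := by
    rw [hmap, Complex.norm_real]
    exact (hpow l i).trans (le_abs_self _)
  have h3 : (1 : ℝ) ≤ ‖(A.map ((↑) : ℝ → ℂ)) ^ l‖ :=
    calc 1 ≤ _ := h2
      _ ≤ _ := norm_le_pi_norm _ i
      _ ≤ _ := linfty_opNorm_mulVec _ _
      _ ≤ _ := mul_le_of_le_one_right (norm_nonneg _) h1
  exact_mod_cast h3

/-- An irreducible matrix with natural number entries has spectral radius at least `1`. -/
lemma IsIrreducible.one_le_spectralRadius [Nonempty n] {A : Matrix n n ℝ} (hA : A.IsIrreducible)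
    (hnat : ∀ i j, ∃ l : ℕ, A i j = l) : 1 ≤ spectralRadius ℂ (A.map ((↑) : ℝ → ℂ)) := by
  refine one_le_spectralRadius_of_one_le_mulVec hA.nonneg fun i => ?_
  obtain ⟨l, hl, hpos⟩ := (isIrreducible_iff_exists_pow_pos hA.nonneg).1 hA i i
  -- Since the exponent is at least `1`, a factor `A` splits off on the left, so row `i` of `A` has
  -- a nonzero entry, hence one that is at least `1`.
  obtain ⟨l, rfl⟩ := Nat.exists_eq_succ_of_ne_zero hl.ne'
  rw [pow_succ', mul_apply] at hpos
  obtain ⟨j, -, hj⟩ := Finset.exists_ne_zero_of_sum_ne_zero hpos.ne'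
  obtain ⟨a, ha⟩ := hnat i j
  have ha1 : (1 : ℝ) ≤ a := by
    rw [Nat.one_le_cast, Nat.one_le_iff_ne_zero]
    rintro rfl
    simp [ha] at hj
  calc (1 : ℝ) ≤ A i j := ha1.trans_eq ha.symm
    _ ≤ ∑ j, A i j := Finset.single_le_sum (fun j _ => hA.nonneg i j) (Finset.mem_univ j)
    _ = (A *ᵥ 1) i := by simp [mulVec, dotProduct]

/-- A real eigenvalue is bounded by the spectral radius. -/
lemma ofReal_le_spectralRadius {A : Matrix n n ℝ} {m : n → ℝ} {c : ℝ} (hm : m ≠ 0)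
    (h : A *ᵥ m = c • m) :
    ENNReal.ofReal c ≤ spectralRadius ℂ (A.map ((↑) : ℝ → ℂ)) := by
  have hmem : (c : ℂ) ∈ spectrum ℂ (A.map ((↑) : ℝ → ℂ)) := by
    refine mem_spectrum_of_mulVec_eq_smul (x := fun i => (m i : ℂ)) ?_ ?_
    · exact fun h0 => hm (funext fun i => by simpa using congrFun h0 i)
    · ext i
      simpa [mulVec, dotProduct] using congrArg ((↑) : ℝ → ℂ) (congrFun h i)
  refine le_trans ?_ (le_iSup₂ (f := fun z (_ : z ∈ spectrum ℂ (A.map ((↑) : ℝ → ℂ))) =>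
    (‖z‖₊ : ℝ≥0∞)) _ hmem)
  rw [← enorm_eq_nnnorm, ← ofReal_norm, Complex.norm_real]
  exact ENNReal.ofReal_le_ofReal (le_abs_self c)

end Matrix

/-! ### Projections and positive functionals. -/

/-- In a star ring, `q - ∑ tᵢ tᵢ*` is a projection if the `tᵢ` are partial isometries with mutually
orthogonal ranges below the projection `q`. -/
lemma IsStarProjection.sub_sum_mul_star {ι B : Type*} [Fintype ι] [NonUnitalRing B] [StarRing B]
    {q : B} (hq : IsStarProjection q) (t : ι → B) (ht : ∀ i, t i * star (t i) * t i = t i)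
    (hqt : ∀ i, q * t i = t i) (horth : ∀ i j, i ≠ j → star (t i) * t j = 0) :
    IsStarProjection (q - ∑ i, t i * star (t i)) := by
  classical
  set s := ∑ i, t i * star (t i) with hs
  have hstar : star s = s := by simp [hs, star_sum]
  have hqs : q * s = s := by
    rw [hs, Finset.mul_sum]
    exact Finset.sum_congr rfl fun i _ => by rw [← mul_assoc, hqt]
  have hsq : s * q = s := by
    rw [← hstar, ← hq.isSelfAdjoint.star_eq, ← star_mul, hqs]
  have hss : s * s = s := by
    conv_lhs => rw [hs, Finset.sum_mul]
    refine Finset.sum_congr rfl fun i _ => ?_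
    rw [Finset.mul_sum, Finset.sum_eq_single i]
    · rw [← mul_assoc, ht]
    · intro j _ hj
      rw [mul_assoc, ← mul_assoc (star (t i)), horth i j hj.symm, zero_mul, mul_zero]
    · simp
  constructor
  · rw [IsIdempotentElem, sub_mul, mul_sub, mul_sub, hq.isIdempotentElem.eq, hqs, hsq, hss]
    simp
  · rw [IsSelfAdjoint, star_sub, hstar, hq.isSelfAdjoint.star_eq]

section PositiveFunctional

variable {A : Type*} [NonUnitalCStarAlgebra A]

/-- The degenerate case of the Cauchy-Schwarz inequality. -/
lemma apply_star_mul_eq_zero_of_nonneg (φ : A →L[ℂ] ℂ) (hφ : ∀ a, 0 ≤ φ (star a * a)) {a : A}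
    (ha : φ (star a * a) = 0) (x : A) : φ (star a * x) = 0 := by
  set u := φ (star a * x)
  set w := φ (star x * a)
  set c := φ (star x * x)
  -- The term in `|z|²` is `φ (star a * a) = 0`, so only a real-affine function of `z` remains.
  have key : ∀ z : ℂ, 0 ≤ star z * u + z * w + c := by
    intro z
    have h := hφ (z • a + x)
    have : φ (star (z • a + x) * (z • a + x)) = star z * u + z * w + c := by
      simp only [star_add, star_smul, add_mul, mul_add, map_add, smul_mul_assoc, mul_smul_comm,
        map_smul, ha, smul_eq_mul, u, w, c]
      ring
    rwa [this] at h
  -- An affine function bounded below on the line is constant: at `t = -(c.re + 1) / y.re` the real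
  -- part would be `-1`. The cases `z = t` and `z = t * I` then separate `u` from `w`.
  have aux : ∀ y : ℂ, (∀ t : ℝ, 0 ≤ t * y + c) → y = 0 := by
    intro y hy
    have h0 := Complex.nonneg_iff.1 (hy 0)
    have h1 := Complex.nonneg_iff.1 (hy 1)
    have hre : y.re = 0 := by
      by_contra hne
      have h2 := (Complex.nonneg_iff.1 (hy (-(c.re + 1) / y.re))).1
      simp only [Complex.add_re, Complex.re_ofReal_mul, div_mul_cancel₀ _ hne] at h2
      linarith
    refine Complex.ext hre ?_
    have h2 := h0.2
    have h3 := h1.2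
    simp at h2 h3 ⊢
    linarith
  have h1 : u + w = 0 := aux _ fun t => by
    convert key t using 1
    simp; ring
  have h2 : -Complex.I * u + Complex.I * w = 0 := aux _ fun t => by
    convert key (t * Complex.I) using 1
    simp; ring
  have h3 : (2 : ℂ) * u = 0 := by
    linear_combination h1 + Complex.I * h2 + (u - w) * Complex.I_sq
  simpa using h3

end PositiveFunctional

/-! ### Relations and unit of the universal algebra. -/

namespace KGraph

variable {k : ℕ} {V : Type u} [SmallCategory V] (Λ : KGraph k V)

lemma IsFinite.finite_pathsInto {Λ : KGraph k V} (h : Λ.IsFinite) (v : V) (n : Fin k → ℕ) :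
    Finite (Λ.PathsInto v n) := by
  have := (h n).to_subtype
  refine Finite.of_injective (β := {p : Σ (w v : V), (w ⟶ v) | Λ.d p.2.2 = n})
    (fun p => ⟨⟨p.1.1, v, p.1.2⟩, p.2⟩) ?_
  rintro ⟨⟨w, f⟩, hf⟩ ⟨⟨w', f'⟩, hf'⟩ heq
  simp only [Subtype.mk.injEq, Sigma.mk.injEq] at heq
  obtain ⟨rfl, heq⟩ := heq
  simp only [heq_eq_eq, Sigma.mk.injEq, true_and] at heq
  subst heq
  rfl

/-- Distinct paths of the same degree have no common extensions. -/
lemma isEmpty_minExt {v : V} {n : Fin k → ℕ} {p q : Λ.PathsInto v n} (hpq : p ≠ q) :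
    IsEmpty (Λ.MinExt p.1.2 q.1.2) := by
  refine ⟨fun ⟨⟨x, η, ζ⟩, heq, hd⟩ => hpq ?_⟩
  obtain ⟨⟨w, μ⟩, hμ⟩ := p
  obtain ⟨⟨w', ν⟩, hν⟩ := q
  dsimp only at *
  have hη : Λ.d η = 0 := by
    rw [Λ.d_comp, hμ, hν, sup_idem] at hd
    simpa using hd
  have hζ : Λ.d ζ = 0 := by
    rw [heq, Λ.d_comp, hμ, hν, sup_idem] at hd
    simpa using hd
  -- The join of equal degrees is `n`, so the extensions have degree `0`, and one path has two
  -- factorisations of type `n + 0`.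
  have h := (Λ.factorisation (η ≫ μ) n 0 (by rw [Λ.d_comp, hη, hμ, zero_add, add_zero])).unique
    (y₁ := ⟨w, η, μ⟩) (y₂ := ⟨w', ζ, ν⟩) ⟨hμ, hη, rfl⟩ ⟨hν, hζ, heq.symm⟩
  simp only [Sigma.mk.injEq] at h
  obtain ⟨rfl, h⟩ := h
  simp only [heq_eq_eq, Prod.mk.injEq] at h
  obtain ⟨-, rfl⟩ := h
  rfl

variable (κ : Kind)

/-- Evaluation of an element of the universal algebra in a family. -/
noncomputable def eval {Λ : KGraph k V} {κ : Kind} (R : Λ.Family κ) : Λ.Alg κ →+ R.B where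
  toFun x := x.1 R
  map_zero' := rfl
  map_add' _ _ := rfl

variable {Λ κ}

/-- Elements are functions on all families, so a relation valid in every family holds for the
universal generators. -/
lemma alg_ext {x y : Λ.Alg κ} (h : ∀ R : Λ.Family κ, eval R x = eval R y) : x = y :=
  Subtype.ext (lp.ext (funext h))

lemma eval_mul (R : Λ.Family κ) (x y : Λ.Alg κ) : eval R (x * y) = eval R x * eval R y := rfl

lemma eval_star (R : Λ.Family κ) (x : Λ.Alg κ) : eval R (star x) = star (eval R x) := rfl

lemma eval_gen (R : Λ.Family κ) {w v : V} (f : w ⟶ v) : eval R (Λ.gen κ f) = R.T f := rfl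

lemma isStarProjection_gen_id (v : V) : IsStarProjection (Λ.gen κ (𝟙 v)) where
  isIdempotentElem := alg_ext fun R => by
    rw [eval_mul, eval_gen]; exact (R.tck.T1_proj v).isIdempotentElem
  isSelfAdjoint := alg_ext fun R => by
    rw [eval_star, eval_gen]; exact (R.tck.T1_proj v).isSelfAdjoint

lemma gen_mul_gen {x w v : V} (μ : x ⟶ w) (f : w ⟶ v) :
    Λ.gen κ f * Λ.gen κ μ = Λ.gen κ (μ ≫ f) :=
  alg_ext fun R => R.tck.T2 μ f

lemma gen_id_mul_gen_id {v w : V} (h : v ≠ w) : Λ.gen κ (𝟙 v) * Λ.gen κ (𝟙 w) = 0 :=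
  alg_ext fun R => R.tck.T1_orth v w h

lemma star_gen_mul_gen {w v : V} (f : w ⟶ v) : star (Λ.gen κ f) * Λ.gen κ f = Λ.gen κ (𝟙 w) :=
  alg_ext fun R => R.tck.T3 f

lemma gen_mul_star_mul_gen {w v : V} (f : w ⟶ v) :
    Λ.gen κ f * star (Λ.gen κ f) * Λ.gen κ f = Λ.gen κ f :=
  alg_ext fun R => R.tck.partial_isometry f

lemma star_gen_mul_gen_eq_zero {v : V} {n : Fin k → ℕ} {p q : Λ.PathsInto v n} (hpq : p ≠ q) :
    star (Λ.gen κ p.1.2) * Λ.gen κ q.1.2 = 0 :=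
  alg_ext fun R => by
    have := Λ.isEmpty_minExt hpq
    rw [eval_mul, eval_star, eval_gen, eval_gen, R.tck.T5, finsum_of_isEmpty, map_zero]

/-- The defect in the Cuntz-Krieger relation is a projection. -/
lemma isStarProjection_defect (v : V) (n : Fin k → ℕ) [Fintype (Λ.PathsInto v n)] :
    IsStarProjection (Λ.gen κ (𝟙 v) -
      ∑ p : Λ.PathsInto v n, Λ.gen κ p.1.2 * star (Λ.gen κ p.1.2)) :=
  (isStarProjection_gen_id v).sub_sum_mul_star _ (fun p => gen_mul_star_mul_gen p.1.2)
    (fun p => by rw [gen_mul_gen, Category.comp_id]) fun _ _ => star_gen_mul_gen_eq_zero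

lemma gen_id_eq_sum (v : V) (n : Fin k → ℕ) [Fintype (Λ.PathsInto v n)] :
    Λ.gen Kind.cuntzKrieger (𝟙 v) = ∑ p : Λ.PathsInto v n,
      Λ.gen Kind.cuntzKrieger p.1.2 * star (Λ.gen Kind.cuntzKrieger p.1.2) :=
  alg_ext fun R => by
    rw [map_sum]
    exact (R.ck rfl v n).trans (finsum_eq_sum_of_fintype _)

variable [Fintype V]

lemma gen_mul_sum_gen_id {w v : V} (f : w ⟶ v) :
    Λ.gen κ f * ∑ x, Λ.gen κ (𝟙 x) = Λ.gen κ f := by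
  classical
  rw [Finset.mul_sum, Finset.sum_eq_single w]
  · rw [gen_mul_gen, Category.id_comp]
  · intro x _ hx
    rw [← Category.id_comp f, ← gen_mul_gen, mul_assoc, gen_id_mul_gen_id hx.symm, mul_zero]
  · simp

lemma sum_gen_id_mul_gen {w v : V} (f : w ⟶ v) :
    (∑ x, Λ.gen κ (𝟙 x)) * Λ.gen κ f = Λ.gen κ f := by
  classical
  rw [Finset.sum_mul, Finset.sum_eq_single v]
  · rw [gen_mul_gen, Category.comp_id]
  · intro x _ hx
    rw [← Category.comp_id f, ← gen_mul_gen, ← mul_assoc, gen_id_mul_gen_id hx, zero_mul]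
  · simp

lemma star_sum_gen_id : star (∑ x, Λ.gen κ (𝟙 x)) = ∑ x, Λ.gen κ (𝟙 x) := by
  rw [star_sum]
  exact Finset.sum_congr rfl fun x _ => (isStarProjection_gen_id x).isSelfAdjoint

/-- The sum of the vertex projections is a unit for the universal algebra. -/
lemma sum_gen_id_mul (x : Λ.Alg κ) : (∑ v, Λ.gen κ (𝟙 v)) * x = x := by
  set p := ∑ v, Λ.gen κ (𝟙 v) with hp
  have hclosed : IsClosed {y : Λ.BigProduct κ | p.1 * y = y} :=
    isClosed_eq (continuous_const.mul continuous_id) continuous_id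
  -- Both sides are carried through the induction because taking adjoints exchanges them.
  have hadj : ∀ y ∈ NonUnitalStarAlgebra.adjoin ℂ
      {x | ∃ (w v : V) (f : w ⟶ v), x = Λ.bigGen κ f}, p.1 * y = y ∧ y * p.1 = y := by
    intro y hy
    induction hy using NonUnitalStarAlgebra.adjoin_induction with
    | mem y hy =>
      obtain ⟨w, v, f, rfl⟩ := hy
      exact ⟨congrArg Subtype.val (sum_gen_id_mul_gen f),
        congrArg Subtype.val (gen_mul_sum_gen_id f)⟩
    | add y z _ _ hy hz => rw [mul_add, add_mul, hy.1, hy.2, hz.1, hz.2]; simp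
    | zero => simp
    | mul y z _ _ hy hz => exact ⟨by rw [← mul_assoc, hy.1], by rw [mul_assoc, hz.2]⟩
    | smul c y _ hy => exact ⟨by rw [mul_smul_comm, hy.1], by rw [smul_mul_assoc, hy.2]⟩
    | star y _ hy =>
      have hps : star p.1 = p.1 := congrArg Subtype.val star_sum_gen_id
      exact ⟨by rw [← hps, ← star_mul, hy.2], by rw [← hps, ← star_mul, hy.1]⟩
  exact Subtype.ext (closure_minimal (fun y hy => (hadj y hy).1) hclosed x.2)

/-- A positive functional vanishing on all vertex projections is zero. -/
lemma eq_zero_of_gen_id_eq_zero (φ : Λ.Alg κ →L[ℂ] ℂ) (hφ : ∀ a, 0 ≤ φ (star a * a))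
    (h : ∀ v, φ (Λ.gen κ (𝟙 v)) = 0) : φ = 0 := by
  ext x
  -- With `p` the unit, `x = star p * x` and `φ (star p * p) = φ p = 0`, so degenerate
  -- Cauchy-Schwarz applies.
  rw [← sum_gen_id_mul x, ← star_sum_gen_id]
  refine apply_star_mul_eq_zero_of_nonneg φ hφ ?_ x
  rw [star_sum_gen_id, sum_gen_id_mul, map_sum]
  exact Finset.sum_eq_zero fun v _ => h v

end KGraph

/-! ### KMS states and their vertex weights. -/

namespace KGraph

variable {k : ℕ} {V : Type u} [SmallCategory V] {Λ : KGraph k V} {κ : Kind}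

lemma zpow_exp (r : Fin k → ℝ) (t : ℝ) (n : Fin k → ℕ) :
    (zpow (fun i => Circle.exp (t * r i)) n : ℂ) =
      Complex.exp (Complex.I * t * ((∑ i, r i * n i : ℝ) : ℂ)) := by
  refine (map_prod Circle.coeHom _ _).trans ?_
  push_cast
  rw [Finset.mul_sum, Complex.exp_sum]
  refine Finset.prod_congr rfl fun i _ => ?_
  have h : Circle.coeHom (Circle.exp (t * r i)) = Complex.exp ((t * r i : ℝ) * Complex.I) :=
    Circle.coe_exp _
  rw [map_pow, h, ← Complex.exp_nat_mul]
  congr 1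
  push_cast
  ring

/-- A generator is an eigenvector of the gauge action, so its orbit is an exponential times a fixed
element; at `z = iβ` the scalar is `exp(-β r·d(f))`. -/
lemma isEntireOrbit_gen (r : Fin k → ℝ) {w v : V} (f : w ⟶ v) :
    IsEntireOrbit (Λ.dynamics κ r) (Λ.gen κ f)
      fun z => Complex.exp (Complex.I * z * ((∑ i, r i * Λ.d f i : ℝ) : ℂ)) • Λ.gen κ f := by
  refine ⟨by fun_prop, fun t => ?_⟩
  rw [dynamics, gauge_gen, zpow_exp]

lemma isEntireOrbit_star_gen (r : Fin k → ℝ) {w v : V} (f : w ⟶ v) :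
    IsEntireOrbit (Λ.dynamics κ r) (star (Λ.gen κ f)) fun z =>
      Complex.exp (-(Complex.I * z * ((∑ i, r i * Λ.d f i : ℝ) : ℂ))) • star (Λ.gen κ f) := by
  refine ⟨by fun_prop, fun t => ?_⟩
  rw [map_star, dynamics, gauge_gen, zpow_exp, star_smul, Complex.star_def, ← Complex.exp_conj]
  simp

/-- The value of a KMS state on the range projection of a path. -/
lemma apply_gen_mul_star_gen {r : Fin k → ℝ} {β : ℝ} (hβ : 0 ≤ β) {φ : Λ.Alg κ →L[ℂ] ℂ}
    (hφ : IsKMSState (Λ.dynamics κ r) β φ) {w v : V} (f : w ⟶ v) :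
    φ (Λ.gen κ f * star (Λ.gen κ f)) =
      Real.exp (-(β * ∑ i, r i * Λ.d f i)) * φ (Λ.gen κ (𝟙 w)) := by
  -- At `β = 0` the trace property replaces the KMS identity and the exponential factor is `1`.
  rcases hβ.eq_or_lt with rfl | hβ
  · rw [(hφ.2.2 rfl).1, star_gen_mul_gen]
    simp
  · rw [hφ.2.1 hβ _ _ _ (isEntireOrbit_gen r f) ⟨_, isEntireOrbit_star_gen r f⟩, mul_smul_comm,
      star_gen_mul_gen, map_smul, smul_eq_mul]
    congr 1
    push_cast
    congr 1
    linear_combination (β * ∑ i, (r i * Λ.d f i : ℂ)) * Complex.I_sq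

/-- Group the paths by source: exactly `A_i(v, w)` of them start at `w`. -/
lemma sum_pathsInto [Fintype V] (v : V) (i : Fin k) [Fintype (Λ.PathsInto v (Pi.single i 1))]
    (m : V → ℝ) :
    ∑ p : Λ.PathsInto v (Pi.single i 1), m p.1.1 = (Λ.vertexMatrix i).mulVec m v := by
  classical
  let e : Λ.PathsInto v (Pi.single i 1) ≃ Σ w, {f : w ⟶ v // Λ.d f = Pi.single i 1} :=
    { toFun p := ⟨p.1.1, p.1.2, p.2⟩
      invFun p := ⟨⟨p.1, p.2.1⟩, p.2.2⟩ }
  -- Needed because `Nat.card` of an infinite type is `0`.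
  have hf : ∀ w, Finite {f : w ⟶ v // Λ.d f = Pi.single i 1} := fun w =>
    Finite.of_injective (fun f => e.symm ⟨w, f⟩) (e.symm.injective.comp sigma_mk_injective)
  have := fun w => Fintype.ofFinite {f : w ⟶ v // Λ.d f = Pi.single i 1}
  refine (Fintype.sum_equiv e _ (fun p => m p.1) fun _ => rfl).trans ?_
  rw [Fintype.sum_sigma]
  simp [Matrix.mulVec, dotProduct, vertexMatrix, Nat.card_eq_fintype_card]

section KMS

variable {r : Fin k → ℝ} {β : ℝ} {φ : Λ.Alg κ →L[ℂ] ℂ}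

lemma apply_gen_id (hφ : ∀ a, 0 ≤ φ (star a * a)) (v : V) :
    0 ≤ (φ (Λ.gen κ (𝟙 v))).re ∧ φ (Λ.gen κ (𝟙 v)) = ((φ (Λ.gen κ (𝟙 v))).re : ℂ) := by
  have h := hφ (Λ.gen κ (𝟙 v))
  rw [star_gen_mul_gen] at h
  obtain ⟨h1, h2⟩ := Complex.nonneg_iff.1 h
  exact ⟨h1, Complex.ext rfl (by simpa using h2.symm)⟩

variable [Fintype V]

lemma sum_apply_gen_mul_star_gen (hβ : 0 ≤ β) (hφ : IsKMSState (Λ.dynamics κ r) β φ) (v : V)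
    (i : Fin k) [Fintype (Λ.PathsInto v (Pi.single i 1))] :
    φ (∑ p : Λ.PathsInto v (Pi.single i 1), Λ.gen κ p.1.2 * star (Λ.gen κ p.1.2)) =
      ((Real.exp (-(β * r i)) *
        (Λ.vertexMatrix i).mulVec (fun v => (φ (Λ.gen κ (𝟙 v))).re) v : ℝ) : ℂ) := by
  rw [← sum_pathsInto, Finset.mul_sum, map_sum, Complex.ofReal_sum]
  refine Finset.sum_congr rfl fun p _ => ?_
  rw [apply_gen_mul_star_gen hβ hφ, p.2, (apply_gen_id hφ.1.1 _).2]
  simp [Pi.single_apply]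

/-- The vertex weights of a KMS state are subinvariant. -/
lemma mulVec_le_of_isKMSState (hfin : Λ.IsFinite) (hβ : 0 ≤ β)
    (hφ : IsKMSState (Λ.dynamics κ r) β φ) (i : Fin k) :
    (Λ.vertexMatrix i).mulVec (fun v => (φ (Λ.gen κ (𝟙 v))).re) ≤
      Real.exp (β * r i) • fun v => (φ (Λ.gen κ (𝟙 v))).re := by
  intro v
  have := hfin.finite_pathsInto v (Pi.single i 1)
  have := Fintype.ofFinite (Λ.PathsInto v (Pi.single i 1))
  -- Positivity of `φ` concerns elements `star a * a`. The witness in (T4) lives in a single family,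
  -- whereas the defect, being a projection, is its own witness in the universal algebra.
  have hp := isStarProjection_defect (Λ := Λ) (κ := κ) v (Pi.single i 1)
  have h := hφ.1.1 (Λ.gen κ (𝟙 v) -
    ∑ p : Λ.PathsInto v (Pi.single i 1), Λ.gen κ p.1.2 * star (Λ.gen κ p.1.2))
  rw [hp.isSelfAdjoint.star_eq, hp.isIdempotentElem.eq, map_sub,
    sum_apply_gen_mul_star_gen hβ hφ, (apply_gen_id hφ.1.1 v).2, ← Complex.ofReal_sub,
    Complex.zero_le_real, sub_nonneg, Real.exp_neg, inv_mul_le_iff₀ (Real.exp_pos _)] at h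
  exact h

/-- The vertex weights of a KMS state of the Cuntz-Krieger algebra are an eigenvector. -/
lemma mulVec_eq_of_isKMSState {φ : Λ.CKAlg →L[ℂ] ℂ} (hfin : Λ.IsFinite) (hβ : 0 ≤ β)
    (hφ : IsKMSState (Λ.dynamics Kind.cuntzKrieger r) β φ) (i : Fin k) :
    (Λ.vertexMatrix i).mulVec (fun v => (φ (Λ.gen Kind.cuntzKrieger (𝟙 v))).re) =
      Real.exp (β * r i) • fun v => (φ (Λ.gen Kind.cuntzKrieger (𝟙 v))).re := by
  ext v
  have := hfin.finite_pathsInto v (Pi.single i 1)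
  have := Fintype.ofFinite (Λ.PathsInto v (Pi.single i 1))
  have h := congrArg φ (gen_id_eq_sum (Λ := Λ) v (Pi.single i 1))
  rw [sum_apply_gen_mul_star_gen hβ hφ, (apply_gen_id hφ.1.1 v).2, Complex.ofReal_inj,
    Real.exp_neg, eq_inv_mul_iff_mul_eq₀ (Real.exp_pos _).ne'] at h
  exact h.symm

lemma vertexWeights_ne_zero (hφ : IsKMSState (Λ.dynamics κ r) β φ) :
    (fun v => (φ (Λ.gen κ (𝟙 v))).re) ≠ 0 := by
  intro h
  have h0 : φ = 0 := eq_zero_of_gen_id_eq_zero φ hφ.1.1 fun v => by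
    rw [(apply_gen_id hφ.1.1 v).2, show (φ (Λ.gen κ (𝟙 v))).re = 0 from congrFun h v,
      Complex.ofReal_zero]
  have := hφ.1.2
  simp [h0] at this

variable [DecidableEq V]

lemma one_le_rho (hirr : Λ.CoordinatewiseIrreducible) [Nonempty V] (i : Fin k) :
    1 ≤ Λ.rho i := by
  have h := (hirr i).one_le_spectralRadius fun v w => ⟨_, rfl⟩
  simpa [rho] using ENNReal.toReal_mono (Matrix.spectralRadius_ne_top _) h

lemma bounds_of_isKMSState (hfin : Λ.IsFinite) (hirr : Λ.CoordinatewiseIrreducible) (hβ : 0 ≤ β)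
    (hφ : IsKMSState (Λ.dynamics κ r) β φ) (i : Fin k) :
    1 ≤ Λ.rho i ∧ Λ.rho i ≤ Real.exp (β * r i) := by
  have hm := vertexWeights_ne_zero hφ
  -- The nonzero weight vector supplies a vertex, without which `1 ≤ ρ` could fail.
  obtain ⟨v, -⟩ := Function.ne_iff.1 hm
  have : Nonempty V := ⟨v⟩
  have hle := mulVec_le_of_isKMSState hfin hβ hφ i
  have hpos := (hirr i).pos_of_mulVec_le (Real.exp_pos _).le
    (fun v => (apply_gen_id hφ.1.1 v).1) hm hle
  exact ⟨one_le_rho hirr i, ENNReal.toReal_le_of_le_ofReal (Real.exp_pos _).le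
    (Matrix.spectralRadius_le_of_mulVec_le (hirr i).nonneg hpos hle)⟩

end KMS

end KGraph

theorem corollary4p3 {k : ℕ} {V : Type u} [SmallCategory V] [Fintype V] [DecidableEq V]
    (Λ : KGraph k V) (hfin : Λ.IsFinite) (hirr : Λ.CoordinatewiseIrreducible)
    (r : Fin k → ℝ) (hr : ∀ i, 0 < r i) (β : ℝ) (hβ : 0 ≤ β) :
    ((∃ φ : Λ.ToeplitzAlg →L[ℂ] ℂ, IsKMSState (Λ.dynamics KGraph.Kind.toeplitz r) β φ) →
      ∀ i, 0 < Λ.rho i ∧ β * r i ≥ Real.log (Λ.rho i) ∧ Real.log (Λ.rho i) ≥ 0) ∧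
    ((∃ φ : Λ.CKAlg →L[ℂ] ℂ, IsKMSState (Λ.dynamics KGraph.Kind.cuntzKrieger r) β φ) →
      ∀ i, 0 < Λ.rho i ∧ β * r i = Real.log (Λ.rho i)) := by
  refine ⟨fun ⟨φ, hφ⟩ i => ?_, fun ⟨φ, hφ⟩ i => ?_⟩
  · obtain ⟨h1, h2⟩ := KGraph.bounds_of_isKMSState hfin hirr hβ hφ i
    have h0 : 0 < Λ.rho i := one_pos.trans_le h1
    exact ⟨h0, (Real.log_le_iff_le_exp h0).2 h2, Real.log_nonneg h1⟩
  · obtain ⟨h1, h2⟩ := KGraph.bounds_of_isKMSState hfin hirr hβ hφ i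
    have h0 : 0 < Λ.rho i := one_pos.trans_le h1
    refine ⟨h0, le_antisymm ((Real.le_log_iff_exp_le h0).2 ?_)
      ((Real.log_le_iff_le_exp h0).2 h2)⟩
    -- In the Cuntz-Krieger case the weights form an eigenvector for `exp(β r_i)`, which therefore
    -- is at most `ρ(A_i)`.
    exact (ENNReal.ofReal_le_iff_le_toReal (Matrix.spectralRadius_ne_top _)).1
      (Matrix.ofReal_le_spectralRadius (KGraph.vertexWeights_ne_zero hφ)
        (KGraph.mulVec_eq_of_isKMSState hfin hβ hφ i))
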